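/- Let $m\in\mathbb{N}$. For $j=1,2$ let $A_j=\{A_j(k)\}_{k\in\mathbb{Z}}$ and $B_j=\{B_j(k)\}_{k\in\mathbb{Z}}$ be sequences of self-adjoint $m\times m$ complex matrices with $A_j(k)>0$ for all $k$ and $\sup_{k}\big(\|A_j(k)\|+\|B_j(k)\|\big)<\infty$. Let $H_j$ be the bounded self-adjoint matrix-valued Jacobi operator in $\ell^2(\mathbb{Z})^m$ given by $$(H_jf)(k)=A_j(k)f(k+1)+A_j(k-1)f(k-1)+B_j(k)f(k),\qquad k\in\mathbb{Z}.$$ Let $G_j(z,k,\ell)=(H_j-z)^{-1}(k,\ell)\in\mathbb{C}^{m\times m}$ ($z\in\mathbb{C}\setminus\mathbb{R}$, $k,\ell\in\mathbb{Z}$) be its Green's matrix, and $g_j(z,k)=G_j(z,k,k)$. Let $k_0\in\mathbb{Z}$, $0<\varepsilon<\pi$, and let $N\ge 2$ be an integer. Suppose that at least one of the following three conditions holds, where all estimates are understood as $|z|\to\infty$ along the ray $\arg(z)=\pi-\varepsilon$: (i) $\|g_1(z,k_0)-g_2(z,k_0)\|+\|G_1(z,k_0,k_0+1)-G_2(z,k_0,k_0+1)\|=O(|z|^{-(N+2)})$;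 (ii) $\|g_1(z,k_0)-g_2(z,k_0)\|+\|G_1(z,k_0,k_0+1)-G_2(z,k_0,k_0+1)+G_1(z,k_0+1,k_0)-G_2(z,k_0+1,k_0)\|=O(|z|^{-(N+2)})$; (iii) $A_1(k_0)=A_2(k_0)$, $\|g_1(z,k_0)-g_2(z,k_0)\|=O(|z|^{-(N+2)})$ and $\|g_1(z,k_0+1)-g_2(z,k_0+1)\|=O(|z|^{-N})$. Then $$A_1(k_0\pm k)=A_2(k_0\pm k),\quad k=0,\dots,\lfloor N/2\rfloor-1,\qquad B_1(k_0\pm k)=B_2(k_0\pm k),\quad k=0,\dots,\lfloor (N-1)/2\rfloor.$$ -/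

import Mathlib

open scoped Matrix.Norms.L2Operator ComplexOrder

/-- The Hilbert space `ℓ²(ℤ)^m` of square-summable sequences `ℤ → ℂ^m`. -/
abbrev EllTwo (m : ℕ) : Type := lp (fun _ : ℤ => EuclideanSpace ℂ (Fin m)) 2

/-- The coefficients of a bounded matrix-valued Jacobi operator: positive definite `A k`,
self-adjoint `B k`, uniformly bounded in `k`.  The norm on matrices is the operator norm induced by
the Euclidean norm on `ℂ^m`. -/
structure JacobiCoeff (m : ℕ) where
  A : ℤ → Matrix (Fin m) (Fin m) ℂ
  B : ℤ → Matrix (Fin m) (Fin m) ℂ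
  posDef_A : ∀ k, (A k).PosDef
  isHermitian_B : ∀ k, (B k).IsHermitian
  bounded : ∃ C : ℝ, 0 < C ∧ ∀ k, ‖A k‖ + ‖B k‖ ≤ C

theorem norm_toEuclideanCLM_apply_le {m : ℕ} {C : ℝ} (T : Matrix (Fin m) (Fin m) ℂ)
    (hT : ‖T‖ ≤ C) (x : EuclideanSpace ℂ (Fin m)) :
    ‖Matrix.toEuclideanCLM (𝕜 := ℂ) T x‖ ≤ C * ‖x‖ :=
  ((Matrix.toEuclideanCLM (𝕜 := ℂ) T).le_opNorm x).trans
    (mul_le_mul_of_nonneg_right hT (norm_nonneg x))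

theorem rpow_norm_toEuclideanCLM_apply_le {m : ℕ} {C : ℝ} (T : Matrix (Fin m) (Fin m) ℂ)
    (hT : ‖T‖ ≤ C) (x : EuclideanSpace ℂ (Fin m)) :
    ‖Matrix.toEuclideanCLM (𝕜 := ℂ) T x‖ ^ (2 : ENNReal).toReal ≤
      C ^ (2 : ENNReal).toReal * ‖x‖ ^ (2 : ENNReal).toReal := by
  rw [← Real.mul_rpow ((norm_nonneg T).trans hT) (norm_nonneg x)]
  exact Real.rpow_le_rpow (norm_nonneg _) (norm_toEuclideanCLM_apply_le T hT x) (by norm_num)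

theorem summable_rpow_norm_shift {m : ℕ} (d : ℤ) (f : EllTwo m) :
    Summable fun k : ℤ => ‖f (k + d)‖ ^ (2 : ENNReal).toReal :=
  ((Equiv.addRight d).summable_iff
    (f := fun k : ℤ => ‖f k‖ ^ (2 : ENNReal).toReal)).2
    ((lp.memℓp f).summable (by norm_num))

theorem memℓp_weightedShift {m : ℕ} (T : ℤ → Matrix (Fin m) (Fin m) ℂ) {C : ℝ}
    (hT : ∀ k, ‖T k‖ ≤ C) (d : ℤ) (f : EllTwo m) :
    Memℓp (fun k : ℤ => Matrix.toEuclideanCLM (𝕜 := ℂ) (T k) (f (k + d))) 2 :=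
  memℓp_gen <| Summable.of_nonneg_of_le (fun _ => by positivity)
    (fun k => rpow_norm_toEuclideanCLM_apply_le (T k) (hT k) (f (k + d)))
    ((summable_rpow_norm_shift d f).mul_left _)

/-- The bounded operator `(f k)_k ↦ (T k f(k + d))_k` on `ℓ²(ℤ)^m`. -/
noncomputable def weightedShift {m : ℕ} (T : ℤ → Matrix (Fin m) (Fin m) ℂ) {C : ℝ}
    (hT : ∀ k, ‖T k‖ ≤ C) (d : ℤ) : EllTwo m →L[ℂ] EllTwo m :=
  LinearMap.mkContinuous
    { toFun := fun f => ⟨fun k => Matrix.toEuclideanCLM (𝕜 := ℂ) (T k) (f (k + d)),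
        memℓp_weightedShift T hT d f⟩
      map_add' := fun f g => by ext1; funext k; exact map_add _ _ _
      map_smul' := fun c f => by
        ext1; funext k
        exact map_smul (Matrix.toEuclideanCLM (𝕜 := ℂ) (T k)) c (f (k + d)) }
    C
    (fun f => by
      have hC : 0 ≤ C := (norm_nonneg (T 0)).trans (hT 0)
      refine lp.norm_le_of_tsum_le (by norm_num) (by positivity) ?_
      rw [Real.mul_rpow hC (norm_nonneg f), lp.norm_rpow_eq_tsum (by norm_num) f,
        ← (Equiv.addRight d).tsum_eq (fun k : ℤ => ‖f k‖ ^ (2 : ENNReal).toReal), ← tsum_mul_left]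
      exact Summable.tsum_le_tsum
        (fun k => rpow_norm_toEuclideanCLM_apply_le (T k) (hT k) (f (k + d)))
        ((memℓp_weightedShift T hT d f).summable (by norm_num))
        ((summable_rpow_norm_shift d f).mul_left _))

namespace JacobiCoeff

variable {m : ℕ} (J : JacobiCoeff m)

theorem norm_A_le (k : ℤ) : ‖J.A k‖ ≤ J.bounded.choose :=
  (le_add_of_nonneg_right (norm_nonneg _)).trans (J.bounded.choose_spec.2 k)

theorem norm_B_le (k : ℤ) : ‖J.B k‖ ≤ J.bounded.choose :=
  (le_add_of_nonneg_left (norm_nonneg _)).trans (J.bounded.choose_spec.2 k)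

/-- The Jacobi operator `H = A S⁺ + A⁻ S⁻ + B`, everywhere defined on `ℓ²(ℤ)^m`. -/
noncomputable def H : EllTwo m →L[ℂ] EllTwo m :=
  weightedShift J.A J.norm_A_le 1
    + weightedShift (fun k => J.A (k - 1)) (fun k => J.norm_A_le (k - 1)) (-1)
    + weightedShift J.B J.norm_B_le 0

/-- `(H f)(k) = A(k) f(k+1) + A(k-1) f(k-1) + B(k) f(k)`. -/
theorem H_apply (f : EllTwo m) (k : ℤ) :
    J.H f k = Matrix.toEuclideanCLM (𝕜 := ℂ) (J.A k) (f (k + 1))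
      + Matrix.toEuclideanCLM (𝕜 := ℂ) (J.A (k - 1)) (f (k - 1))
      + Matrix.toEuclideanCLM (𝕜 := ℂ) (J.B k) (f k) := by
  have h : J.H f k = Matrix.toEuclideanCLM (𝕜 := ℂ) (J.A k) (f (k + 1))
      + Matrix.toEuclideanCLM (𝕜 := ℂ) (J.A (k - 1)) (f (k + -1))
      + Matrix.toEuclideanCLM (𝕜 := ℂ) (J.B k) (f (k + 0)) := rfl
  simpa [← sub_eq_add_neg] using h

/-- The Green's matrix `G(z,k,ℓ) = (H - z)⁻¹(k,ℓ)`: the `m × m` block at position `(k,ℓ)` of the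
inverse of `H - z` in the algebra of bounded operators on `ℓ²(ℤ)^m`; its column `j` is the value at
the site `k` of `(H - z)⁻¹` applied to the `j`-th unit vector placed at the site `ℓ`. -/
noncomputable def G (z : ℂ) (k l : ℤ) : Matrix (Fin m) (Fin m) ℂ :=
  Matrix.of fun i j =>
    (Ring.inverse (J.H - z • (1 : EllTwo m →L[ℂ] EllTwo m))
      (lp.single 2 l (EuclideanSpace.single j (1 : ℂ))) : EllTwo m) k i

/-- The diagonal Green's matrix `g(z,k) = G(z,k,k)`. -/
noncomputable def g (z : ℂ) (k : ℤ) : Matrix (Fin m) (Fin m) ℂ := J.G z k k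

end JacobiCoeff

/-- The filter `|z| → ∞` along the ray `arg z = π - ε`. -/
noncomputable def rayAtInfinity (ε : ℝ) : Filter ℂ :=
  Bornology.cobounded ℂ ⊓ Filter.principal {z : ℂ | z.arg = Real.pi - ε}

/-! Since `H` is bounded, `(H - z)⁻¹ = -∑ z⁻ⁿ⁻¹ Hⁿ` near infinity, so the decay hypotheses say that
finitely many moments `(Hⁿ)(k, l)` of the two operators agree: at `(k₀, k₀)` and `(k₀, k₀+1)` for `n
≤ N` in (i), with the symmetrized off-diagonal moment in (ii), and in (iii) at `(k₀+1, k₀+1)` for `n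
≤ N - 2`.

A moment is a sum over lattice paths (`pathSum`): crossing the edge `{j, j+1}` contributes `A j`,
pausing at `j` contributes `B j`. If the coefficients lower down agree, moments of the first order
that sees `B q` (or `A q`) differ through one extremal path only: climb to `q`, pause there (or
cross to `q + 1` and return), descend. The climb and the descent are products of positive definite
matrices, hence invertible, so `B q`, or `A q * A q` and thus `A q`, is recovered
(`pathSum_sub_pathSum_diag`, `pathSum_sub_pathSum_offDiag`).

The moments at `(k₀, k₀)` alone see the new coefficients on both sides at once. The second family of
moments supplies the right-hand one; then the `(k₀, k₀)` moments give the left-hand one by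
reflection (`eq_of_pathSum_eq_of_right`). In (ii) the symmetrized moment yields `A Y + Y A = 0`,
which forces `Y = 0` because `A > 0`. -/

/-! ### Moments of a Jacobi operator as sums over lattice paths -/

section PathSum

variable {R : Type*} [Ring R]

/-- The `(k, l)` entry of the `n`-th power of the Jacobi operator with coefficients `A`, `B`. -/
def pathSum (A B : ℤ → R) : ℕ → ℤ → ℤ → R
  | 0, k, l => if k = l then 1 else 0
  | n + 1, k, l => A k * pathSum A B n (k + 1) l + A (k - 1) * pathSum A B n (k - 1) l
      + B k * pathSum A B n k l

theorem pathSum_succ (A B : ℤ → R) (n : ℕ) (k l : ℤ) :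
    pathSum A B (n + 1) k l = A k * pathSum A B n (k + 1) l
      + A (k - 1) * pathSum A B n (k - 1) l + B k * pathSum A B n k l := rfl

@[simp]
theorem pathSum_zero_self (A B : ℤ → R) (k : ℤ) : pathSum A B 0 k k = 1 := if_pos rfl

theorem pathSum_eq_zero (A B : ℤ → R) (n : ℕ) (k l : ℤ) (h : (n : ℤ) < |k - l|) :
    pathSum A B n k l = 0 := by
  induction n generalizing k with
  | zero =>
    refine if_neg fun hkl => ?_
    simp [hkl] at h
  | succ n ih =>
    push_cast at h
    rw [pathSum_succ, ih (k + 1), ih (k - 1), ih k] <;> grind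

theorem pathSum_shift (A B : ℤ → R) (c : ℤ) (n : ℕ) (k l : ℤ) :
    pathSum (fun j => A (c + j)) (fun j => B (c + j)) n k l = pathSum A B n (c + k) (c + l) := by
  induction n generalizing k with
  | zero => simp [pathSum]
  | succ n ih => simp only [pathSum_succ, ih, add_assoc, add_sub_assoc]

/-- `A j` lives on the edge `{j, j+1}`, which `j ↦ -j` sends to `{-j-1, -j}`; `B j` lives on the
site `j`. -/
theorem pathSum_reflect (A B : ℤ → R) (n : ℕ) (k l : ℤ) :
    pathSum (fun j => A (-j - 1)) (fun j => B (-j)) n k l = pathSum A B n (-k) (-l) := by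
  induction n generalizing k with
  | zero => simp [pathSum]
  | succ n ih =>
    simp only [pathSum_succ, ih]
    rw [show -(k - 1) - 1 = -k by ring, show -(k + 1) = -k - 1 by ring,
      show -(k - 1) = -k + 1 by ring, add_comm (A (-k - 1) * _)]

/-- An entry of the `n`-th power only depends on the coefficients met by paths of length `n`. -/
theorem pathSum_congr {A₁ A₂ B₁ B₂ : ℤ → R} (n : ℕ) (k l : ℤ)
    (hA : ∀ j, 2 * (j + 1) ≤ n + k + l → k + l - 2 * j ≤ n → A₁ j = A₂ j)
    (hB : ∀ j, 2 * j + 1 ≤ n + k + l → k + l + 1 - 2 * j ≤ n → B₁ j = B₂ j) :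
    pathSum A₁ B₁ n k l = pathSum A₂ B₂ n k l := by
  induction n generalizing k with
  | zero => rfl
  | succ n ih =>
    push_cast at hA hB
    rw [pathSum_succ, pathSum_succ,
      ih (k + 1) (fun j h₁ h₂ => hA j (by lia) (by lia)) (fun j h₁ h₂ => hB j (by lia) (by lia)),
      ih (k - 1) (fun j h₁ h₂ => hA j (by lia) (by lia)) (fun j h₁ h₂ => hB j (by lia) (by lia)),
      ih k (fun j h₁ h₂ => hA j (by lia) (by lia)) (fun j h₁ h₂ => hB j (by lia) (by lia))]
    congr 1
    · congr 1
      -- The coefficient matters only if the rest of the path can still reach `l`; that condition is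
      -- exactly the range in which agreement is assumed.
      · by_cases h : (n : ℤ) < |k + 1 - l|
        · simp [pathSum_eq_zero _ _ _ _ _ h]
        · rw [hA k (by grind) (by grind)]
      · by_cases h : (n : ℤ) < |k - 1 - l|
        · simp [pathSum_eq_zero _ _ _ _ _ h]
        · rw [hA (k - 1) (by grind) (by grind)]
    · by_cases h : (n : ℤ) < |k - l|
      · simp [pathSum_eq_zero _ _ _ _ _ h]
      · rw [hB k (by grind) (by grind)]

theorem pathSum_succ_down (A B : ℤ → R) (n : ℕ) (k l : ℤ) (h : k = l + n) :
    pathSum A B (n + 1) (k + 1) l = A k * pathSum A B n k l := by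
  rw [pathSum_succ, pathSum_eq_zero _ _ _ (k + 1 + 1) l (by grind),
    pathSum_eq_zero _ _ _ (k + 1) l (by grind)]
  simp

theorem pathSum_succ_up (A B : ℤ → R) (n : ℕ) (k l : ℤ) (h : k + 1 + n = l) :
    pathSum A B (n + 1) k l = A k * pathSum A B n (k + 1) l := by
  rw [pathSum_succ, pathSum_eq_zero _ _ _ (k - 1) l (by grind),
    pathSum_eq_zero _ _ _ k l (by grind)]
  simp

theorem pathSum_succ_down' (A B : ℤ → R) (n : ℕ) (k l : ℤ) (h : k = l + 1 + n) :
    pathSum A B (n + 1) k l = pathSum A B n k (l + 1) * A l := by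
  induction n generalizing k with
  | zero =>
    obtain rfl : k = l + 1 := by simpa using h
    rw [pathSum_succ_down _ _ _ _ _ (by simp)]
    simp
  | succ n ih =>
    push_cast at h
    obtain ⟨k, rfl⟩ : ∃ k', k = k' + 1 := ⟨k - 1, by ring⟩
    rw [pathSum_succ_down _ _ _ _ _ (by push_cast; lia), ih k (by lia),
      pathSum_succ_down _ _ _ _ _ (by lia), mul_assoc]

theorem isUnit_pathSum_up {A : ℤ → R} (B : ℤ → R) (hA : ∀ k, IsUnit (A k)) (n : ℕ) (k l : ℤ)
    (h : k + n = l) : IsUnit (pathSum A B n k l) := by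
  induction n generalizing k with
  | zero =>
    obtain rfl : k = l := by simpa using h
    simp
  | succ n ih =>
    push_cast at h
    rw [pathSum_succ_up _ _ _ _ _ (by lia)]
    exact (hA k).mul (ih _ (by lia))

theorem isUnit_pathSum_down {A : ℤ → R} (B : ℤ → R) (hA : ∀ k, IsUnit (A k)) (n : ℕ) (k l : ℤ)
    (h : k = l + n) : IsUnit (pathSum A B n k l) := by
  induction n generalizing k with
  | zero =>
    obtain rfl : k = l := by simpa using h
    simp
  | succ n ih =>
    push_cast at h
    obtain ⟨k, rfl⟩ : ∃ k', k = k' + 1 := ⟨k - 1, by ring⟩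
    rw [pathSum_succ_down _ _ _ _ _ (by lia)]
    exact (hA k).mul (ih _ (by lia))

/-- Only the path through `q + 1` meets `A q`, and it crosses that edge twice. Induction on `a`
peels off the first step: of the three possible steps, only the upward one leads to moments that
differ. The lower bounds are the reach of paths of this length. -/
theorem pathSum_sub_pathSum_offDiag {A₁ A₂ B₁ B₂ : ℤ → R} (q : ℤ) (a b : ℕ)
    (hA : ∀ j, q - a - b - 1 ≤ j → j < q → A₁ j = A₂ j)
    (hB : ∀ j, q - a - b ≤ j → j ≤ q → B₁ j = B₂ j) :
    pathSum A₁ B₁ (a + b + 2) (q - a) (q - b) - pathSum A₂ B₂ (a + b + 2) (q - a) (q - b) =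
      pathSum A₁ B₁ a (q - a) q * (A₁ q * A₁ q - A₂ q * A₂ q) * pathSum A₁ B₁ b q (q - b) := by
  induction a with
  | zero =>
    have h₁ : pathSum A₁ B₁ (b + 1) (q - 1) (q - b) = pathSum A₂ B₂ (b + 1) (q - 1) (q - b) :=
      pathSum_congr _ _ _ (fun j h₁ h₂ => hA j (by lia) (by lia))
        (fun j h₁ h₂ => hB j (by lia) (by lia))
    have h₂ : pathSum A₁ B₁ (b + 1) q (q - b) = pathSum A₂ B₂ (b + 1) q (q - b) :=
      pathSum_congr _ _ _ (fun j h₁ h₂ => hA j (by lia) (by lia))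
        (fun j h₁ h₂ => hB j (by lia) (by lia))
    have h₃ : pathSum A₁ B₁ b q (q - b) = pathSum A₂ B₂ b q (q - b) :=
      pathSum_congr _ _ _ (fun j h₁ h₂ => hA j (by lia) (by lia))
        (fun j h₁ h₂ => hB j (by lia) (by lia))
    have h₄ : A₁ (q - 1) = A₂ (q - 1) := hA _ (by lia) (by lia)
    have h₅ : B₁ q = B₂ q := hB _ (by lia) (by lia)
    simp only [Nat.cast_zero, sub_zero, Nat.zero_add, pathSum_zero_self, one_mul]
    rw [pathSum_succ, pathSum_succ A₂, h₁, h₂, h₄, h₅, pathSum_succ_down _ _ _ _ _ (by lia),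
      pathSum_succ_down _ _ _ _ _ (by lia), h₃]
    noncomm_ring
  | succ a ih =>
    push_cast at hA hB
    have ih := ih (fun j h₁ h₂ => hA j (by lia) h₂) (fun j h₁ h₂ => hB j (by lia) h₂)
    push_cast
    set k : ℤ := q - (a + 1) with hk
    rw [show q - (a : ℤ) = k + 1 by lia] at ih
    have h₁ : pathSum A₁ B₁ (a + b + 2) (k - 1) (q - b)
        = pathSum A₂ B₂ (a + b + 2) (k - 1) (q - b) :=
      pathSum_congr _ _ _ (fun j h₁ h₂ => hA j (by lia) (by lia))
        (fun j h₁ h₂ => hB j (by lia) (by lia))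
    have h₂ : pathSum A₁ B₁ (a + b + 2) k (q - b) = pathSum A₂ B₂ (a + b + 2) k (q - b) :=
      pathSum_congr _ _ _ (fun j h₁ h₂ => hA j (by lia) (by lia))
        (fun j h₁ h₂ => hB j (by lia) (by lia))
    have h₃ : A₁ k = A₂ k := hA _ (by lia) (by lia)
    have h₄ : A₁ (k - 1) = A₂ (k - 1) := hA _ (by lia) (by lia)
    have h₅ : B₁ k = B₂ k := hB _ (by lia) (by lia)
    rw [pathSum_succ_up A₁ B₁ a k q (by lia), mul_assoc (A₁ k), mul_assoc (A₁ k), ← ih, show a + 1 + b + 2 = a + b + 2 + 1 by ring, pathSum_succ, pathSum_succ A₂, h₁, h₂, h₃,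
      h₄, h₅]
    noncomm_ring

theorem pathSum_sub_pathSum_diag {A₁ A₂ B₁ B₂ : ℤ → R} (q : ℤ) (a b : ℕ)
    (hA : ∀ j, q - a - b ≤ j → j < q → A₁ j = A₂ j)
    (hB : ∀ j, q - a - b ≤ j → j < q → B₁ j = B₂ j) :
    pathSum A₁ B₁ (a + b + 1) (q - a) (q - b) - pathSum A₂ B₂ (a + b + 1) (q - a) (q - b) =
      pathSum A₁ B₁ a (q - a) q * (B₁ q - B₂ q) * pathSum A₁ B₁ b q (q - b) := by
  induction a with
  | zero =>
    have h₁ : A₁ (q - 1) * pathSum A₁ B₁ b (q - 1) (q - b)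
        = A₂ (q - 1) * pathSum A₂ B₂ b (q - 1) (q - b) := by
      -- For `b = 0` agreement of `A` at `q - 1` is not assumed, but the path is then too short to
      -- return from there.
      rcases b.eq_zero_or_pos with rfl | hb
      · simp [pathSum_eq_zero]
      · rw [hA (q - 1) (by lia) (by lia)]
        congr 1
        exact pathSum_congr _ _ _ (fun j h₁ h₂ => hA j (by lia) (by lia))
          (fun j h₁ h₂ => hB j (by lia) (by lia))
    have h₂ : pathSum A₁ B₁ b q (q - b) = pathSum A₂ B₂ b q (q - b) :=
      pathSum_congr _ _ _ (fun j h₁ h₂ => hA j (by lia) (by lia))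
        (fun j h₁ h₂ => hB j (by lia) (by lia))
    simp only [Nat.cast_zero, sub_zero, Nat.zero_add, pathSum_zero_self, one_mul]
    rw [pathSum_succ, pathSum_succ A₂, pathSum_eq_zero _ _ _ (q + 1) _ (by grind),
      pathSum_eq_zero _ _ _ (q + 1) _ (by grind), h₁, h₂]
    noncomm_ring
  | succ a ih =>
    push_cast at hA hB
    have ih := ih (fun j h₁ h₂ => hA j (by lia) h₂) (fun j h₁ h₂ => hB j (by lia) h₂)
    push_cast
    set k : ℤ := q - (a + 1) with hk
    rw [show q - (a : ℤ) = k + 1 by lia] at ih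
    have h₁ : A₁ (k - 1) * pathSum A₁ B₁ (a + b + 1) (k - 1) (q - b)
        = A₂ (k - 1) * pathSum A₂ B₂ (a + b + 1) (k - 1) (q - b) := by
      rcases b.eq_zero_or_pos with rfl | hb
      · rw [pathSum_eq_zero _ _ _ _ _ (by grind), pathSum_eq_zero _ _ _ _ _ (by grind)]
        simp
      · rw [hA (k - 1) (by lia) (by lia)]
        congr 1
        exact pathSum_congr _ _ _ (fun j h₁ h₂ => hA j (by lia) (by lia))
          (fun j h₁ h₂ => hB j (by lia) (by lia))
    have h₂ : pathSum A₁ B₁ (a + b + 1) k (q - b) = pathSum A₂ B₂ (a + b + 1) k (q - b) :=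
      pathSum_congr _ _ _ (fun j h₁ h₂ => hA j (by lia) (by lia))
        (fun j h₁ h₂ => hB j (by lia) (by lia))
    have h₃ : A₁ k = A₂ k := hA _ (by lia) (by lia)
    have h₅ : B₁ k = B₂ k := hB _ (by lia) (by lia)
    rw [pathSum_succ_up A₁ B₁ a k q (by lia), mul_assoc (A₁ k), mul_assoc (A₁ k), ← ih, show a + 1 + b + 1 = a + b + 1 + 1 by ring, pathSum_succ, pathSum_succ A₂, h₁, h₂, h₃,
      h₅]
    noncomm_ring

end PathSum

/-! ### Recovering the coefficients from the moments -/

section Determination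

open Matrix

variable {ι : Type*} [Fintype ι] [DecidableEq ι]

/-- Multiplying by `Xᴴ` and taking traces gives a vanishing sum of the nonnegative numbers `tr (Xᴴ A
X)` and `tr (X A' Xᴴ)`; hence `Xᴴ A X = 0`, and definiteness of `A` kills each column of `X`. -/
theorem Matrix.PosDef.eq_zero_of_mul_add_mul_eq_zero {A A' X : Matrix ι ι ℂ} (hA : A.PosDef)
    (hA' : A'.PosDef) (h : A * X + X * A' = 0) : X = 0 := by
  have h₁ : (Xᴴ * A * X).PosSemidef := hA.posSemidef.conjTranspose_mul_mul_same X
  have h₂ : (X * A' * Xᴴ).PosSemidef := hA'.posSemidef.mul_mul_conjTranspose_same X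
  have h₃ : (Xᴴ * A * X).trace + (X * A' * Xᴴ).trace = 0 := by
    rw [trace_mul_comm (X * A'), mul_assoc, ← trace_add, ← mul_add, h, mul_zero, trace_zero]
  have h₄ : (Xᴴ * A * X).trace = 0 :=
    ((add_eq_zero_iff_of_nonneg h₁.trace_nonneg h₂.trace_nonneg).1 h₃).1
  have h₅ : Xᴴ * A * X = 0 := h₁.trace_eq_zero_iff.1 h₄
  refine Matrix.ext_of_mulVec_single fun i => ?_
  rw [zero_mulVec]
  by_contra hx
  have h₆ := hA.dotProduct_mulVec_pos hx
  rw [star_mulVec, ← dotProduct_mulVec, mulVec_mulVec, mulVec_mulVec, h₅] at h₆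
  simp at h₆

/-- The difference `X = A - A'` satisfies `A X + X A' = A² - A'²`. -/
theorem Matrix.PosDef.eq_of_mul_self_eq {A A' : Matrix ι ι ℂ} (hA : A.PosDef) (hA' : A'.PosDef)
    (h : A * A = A' * A') : A = A' := by
  refine sub_eq_zero.1 (hA.eq_zero_of_mul_add_mul_eq_zero hA' ?_)
  rw [mul_sub, sub_mul, h]
  abel

theorem eq_zero_of_isUnit_mul_mul {R : Type*} [Ring R] {u x v : R} (hu : IsUnit u)
    (hv : IsUnit v) (h : u * x * v = 0) : x = 0 := by
  rwa [hv.mul_left_eq_zero, hu.mul_right_eq_zero] at h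

variable {A₁ A₂ B₁ B₂ : ℤ → Matrix ι ι ℂ}

theorem offDiag_eq_of_pathSum_eq (hA₁ : ∀ k, (A₁ k).PosDef) (hA₂ : ∀ k, (A₂ k).PosDef) (q : ℤ)
    (a b : ℕ) (hA : ∀ j, q - a - b - 1 ≤ j → j < q → A₁ j = A₂ j)
    (hB : ∀ j, q - a - b ≤ j → j ≤ q → B₁ j = B₂ j)
    (h : pathSum A₁ B₁ (a + b + 2) (q - a) (q - b) = pathSum A₂ B₂ (a + b + 2) (q - a) (q - b)) :
    A₁ q = A₂ q := by
  have h₁ := pathSum_sub_pathSum_offDiag q a b hA hB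
  rw [h, sub_self] at h₁
  exact (hA₁ q).eq_of_mul_self_eq (hA₂ q) <| sub_eq_zero.1 <| eq_zero_of_isUnit_mul_mul
    (isUnit_pathSum_up B₁ (fun k => (hA₁ k).isUnit) a _ _ (by lia))
    (isUnit_pathSum_down B₁ (fun k => (hA₁ k).isUnit) b _ _ (by lia)) h₁.symm

theorem diag_eq_of_pathSum_eq (hA₁ : ∀ k, (A₁ k).PosDef) (q : ℤ)
    (a b : ℕ) (hA : ∀ j, q - a - b ≤ j → j < q → A₁ j = A₂ j)
    (hB : ∀ j, q - a - b ≤ j → j < q → B₁ j = B₂ j)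
    (h : pathSum A₁ B₁ (a + b + 1) (q - a) (q - b) = pathSum A₂ B₂ (a + b + 1) (q - a) (q - b)) :
    B₁ q = B₂ q := by
  have h₁ := pathSum_sub_pathSum_diag q a b hA hB
  rw [h, sub_self] at h₁
  exact sub_eq_zero.1 <| eq_zero_of_isUnit_mul_mul
    (isUnit_pathSum_up B₁ (fun k => (hA₁ k).isUnit) a _ _ (by lia))
    (isUnit_pathSum_down B₁ (fun k => (hA₁ k).isUnit) b _ _ (by lia)) h₁.symm

/-- If the coefficients to the right of the site `0` can be recovered one after the other, then the
moments at the site `0` determine those to the left as well. -/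
theorem eq_of_pathSum_eq_of_right (hA₁ : ∀ k, (A₁ k).PosDef) (hA₂ : ∀ k, (A₂ k).PosDef) (N : ℕ)
    (h : ∀ n ≤ N, pathSum A₁ B₁ n 0 0 = pathSum A₂ B₂ n 0 0)
    (h₀ : 2 ≤ N → A₁ 0 = A₂ 0)
    (hrA : ∀ q : ℕ, 2 * (q + 1) + 2 ≤ N →
      (∀ j, -((q : ℤ) + 1) ≤ j → j < q + 1 → A₁ j = A₂ j) →
      (∀ j, -((q : ℤ) + 1) ≤ j → j ≤ q + 1 → B₁ j = B₂ j) → A₁ (q + 1) = A₂ (q + 1))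
    (hrB : ∀ q : ℕ, 2 * (q + 1) + 1 ≤ N →
      (∀ j, -((q : ℤ) + 1) ≤ j → j < q + 1 → A₁ j = A₂ j) →
      (∀ j, -((q : ℤ) + 1) < j → j < q + 1 → B₁ j = B₂ j) → B₁ (q + 1) = B₂ (q + 1))
    (n : ℕ) (hn : n ≤ N) :
    (∀ j : ℤ, 2 * (j + 1) ≤ n → -2 * j ≤ n → A₁ j = A₂ j) ∧
    (∀ j : ℤ, 2 * j + 1 ≤ n → -2 * j + 1 ≤ n → B₁ j = B₂ j) := by
  induction n with
  | zero => exact ⟨fun j h₁ h₂ => by lia, fun j h₁ h₂ => by lia⟩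
  | succ n ih =>
    obtain ⟨ihA, ihB⟩ := ih (by lia)
    have hrefl : pathSum (fun j => A₁ (-j - 1)) (fun j => B₁ (-j)) (n + 1) 0 0
        = pathSum (fun j => A₂ (-j - 1)) (fun j => B₂ (-j)) (n + 1) 0 0 := by
      rw [pathSum_reflect, pathSum_reflect, neg_zero, h _ hn]
    push_cast
    -- Order `2q + 1` adds `B` at the sites `±q`; order `2q + 2` adds `A` on the edges starting at
    -- `q` and `-q - 1`.
    obtain ⟨q, rfl | rfl⟩ : ∃ q, n = 2 * q ∨ n = 2 * q + 1 := ⟨n / 2, by lia⟩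
    · push_cast at ihA ihB
      have hR : q ≠ 0 → B₁ q = B₂ q := by
        intro hq
        obtain ⟨q, rfl⟩ := Nat.exists_eq_succ_of_ne_zero hq
        push_cast at ihA ihB ⊢
        exact hrB q (by lia) (fun j h₁ h₂ => ihA j (by lia) (by lia))
          (fun j h₁ h₂ => ihB j (by lia) (by lia))
      -- After reflection the region assumed known contains the original site `q` when `q ≠ 0`, so
      -- `hR` has to come first.
      have hL : B₁ (-q) = B₂ (-q) :=
        diag_eq_of_pathSum_eq (A₁ := fun j => A₁ (-j - 1)) (A₂ := fun j => A₂ (-j - 1))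
          (B₁ := fun j => B₁ (-j)) (B₂ := fun j => B₂ (-j)) (fun k => hA₁ _) q q q
          (fun j h₁ h₂ => ihA _ (by lia) (by lia))
          (fun j h₁ h₂ => by
            by_cases hj : j = -q
            · rw [hj, neg_neg]
              exact hR (by lia)
            · exact ihB _ (by lia) (by lia))
          (by rwa [sub_self, ← two_mul])
      refine ⟨fun j h₁ h₂ => ihA j (by lia) (by lia), fun j h₁ h₂ => ?_⟩
      by_cases hj : j = -q
      · rw [hj, hL]
      by_cases hj' : j = q
      · rw [hj', hR (by lia)]
      exact ihB j (by lia) (by lia)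
    · push_cast at ihA ihB
      have hR : A₁ q = A₂ q := by
        rcases Nat.eq_zero_or_eq_succ_pred q with hq | hq
        · subst hq
          exact h₀ (by lia)
        · generalize q.pred = p at hq
          subst hq
          push_cast at ihA ihB ⊢
          exact hrA p (by lia) (fun j h₁ h₂ => ihA j (by lia) (by lia))
            (fun j h₁ h₂ => ihB j (by lia) (by lia))
      have hL : A₁ (-q - 1) = A₂ (-q - 1) :=
        offDiag_eq_of_pathSum_eq (A₁ := fun j => A₁ (-j - 1)) (A₂ := fun j => A₂ (-j - 1))
          (B₁ := fun j => B₁ (-j)) (B₂ := fun j => B₂ (-j)) (fun k => hA₁ _) (fun k => hA₂ _) q q q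
          (fun j h₁ h₂ => by
            by_cases hj : -j - 1 = q
            · rw [hj, hR]
            · exact ihA _ (by lia) (by lia))
          (fun j h₁ h₂ => ihB _ (by lia) (by lia))
          (by rwa [sub_self, ← two_mul])
      refine ⟨fun j h₁ h₂ => ?_, fun j h₁ h₂ => ihB j (by lia) (by lia)⟩
      by_cases hj : j = -q - 1
      · rw [hj, hL]
      by_cases hj' : j = q
      · rw [hj', hR]
      exact ihA j (by lia) (by lia)

theorem eq_of_pathSum_zero_one_eq (hA₁ : ∀ k, (A₁ k).PosDef) (hA₂ : ∀ k, (A₂ k).PosDef) (N : ℕ)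
    (h : ∀ n ≤ N, pathSum A₁ B₁ n 0 0 = pathSum A₂ B₂ n 0 0)
    (h' : ∀ n ≤ N, pathSum A₁ B₁ n 0 1 = pathSum A₂ B₂ n 0 1) :
    (∀ j : ℤ, 2 * (j + 1) ≤ N → -2 * j ≤ N → A₁ j = A₂ j) ∧
    (∀ j : ℤ, 2 * j + 1 ≤ N → -2 * j + 1 ≤ N → B₁ j = B₂ j) := by
  refine eq_of_pathSum_eq_of_right hA₁ hA₂ N h (fun hN => ?_) (fun q hq hA hB => ?_)
    (fun q hq hA hB => ?_) N le_rfl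
  · simpa [pathSum] using h' 1 (by lia)
  -- The unequal legs `q + 1` and `q` below the top site `q + 1` put the endpoints at `0` and `1`.
  · refine offDiag_eq_of_pathSum_eq hA₁ hA₂ _ (q + 1) q (fun j h₁ h₂ => hA j (by lia) (by lia))
      (fun j h₁ h₂ => hB j (by lia) (by lia)) ?_
    push_cast
    simpa using h' (q + 1 + q + 2) (by lia)
  · refine diag_eq_of_pathSum_eq hA₁ _ (q + 1) q (fun j h₁ h₂ => hA j (by lia) (by lia))
      (fun j h₁ h₂ => hB j (by lia) (by lia)) ?_
    push_cast
    simpa using h' (q + 1 + q + 1) (by lia)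

theorem eq_of_pathSum_one_one_eq (hA₁ : ∀ k, (A₁ k).PosDef) (hA₂ : ∀ k, (A₂ k).PosDef) (N : ℕ)
    (h : ∀ n ≤ N, pathSum A₁ B₁ n 0 0 = pathSum A₂ B₂ n 0 0) (h₀ : A₁ 0 = A₂ 0)
    (h' : ∀ n, n + 2 ≤ N → pathSum A₁ B₁ n 1 1 = pathSum A₂ B₂ n 1 1) :
    (∀ j : ℤ, 2 * (j + 1) ≤ N → -2 * j ≤ N → A₁ j = A₂ j) ∧
    (∀ j : ℤ, 2 * j + 1 ≤ N → -2 * j + 1 ≤ N → B₁ j = B₂ j) := by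
  refine eq_of_pathSum_eq_of_right hA₁ hA₂ N h (fun _ => h₀) (fun q hq hA hB => ?_)
    (fun q hq hA hB => ?_) N le_rfl
  -- Both endpoints are at `1`, so the path to `q + 1` is two steps shorter than from `0`; this is
  -- why moments up to order `N - 2` suffice.
  · refine offDiag_eq_of_pathSum_eq hA₁ hA₂ _ q q (fun j h₁ h₂ => hA j (by lia) (by lia))
      (fun j h₁ h₂ => hB j (by lia) (by lia)) ?_
    simpa using h' (q + q + 2) (by lia)
  · refine diag_eq_of_pathSum_eq hA₁ _ q q (fun j h₁ h₂ => hA j (by lia) (by lia))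
      (fun j h₁ h₂ => hB j (by lia) (by lia)) ?_
    simpa using h' (q + q + 1) (by lia)

theorem eq_of_pathSum_zero_one_add_eq (hA₁ : ∀ k, (A₁ k).PosDef) (hA₂ : ∀ k, (A₂ k).PosDef) (N : ℕ)
    (h : ∀ n ≤ N, pathSum A₁ B₁ n 0 0 = pathSum A₂ B₂ n 0 0)
    (h' : ∀ n ≤ N, pathSum A₁ B₁ n 0 1 - pathSum A₂ B₂ n 0 1
      + pathSum A₁ B₁ n 1 0 - pathSum A₂ B₂ n 1 0 = 0) :
    (∀ j : ℤ, 2 * (j + 1) ≤ N → -2 * j ≤ N → A₁ j = A₂ j) ∧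
    (∀ j : ℤ, 2 * j + 1 ≤ N → -2 * j + 1 ≤ N → B₁ j = B₂ j) := by
  -- Stripping the edge `{0, 1}` from both products leaves `A₁ 0 * Y + Y * A₁ 0 = 0`, where `Y` is
  -- `X` between the two invertible path weights joining `1` and `q + 1`.
  have key : ∀ (q : ℕ) (X : Matrix ι ι ℂ),
      pathSum A₁ B₁ (q + 1) 0 (q + 1) * X * pathSum A₁ B₁ q (q + 1) 1
        + pathSum A₁ B₁ q 1 (q + 1) * X * pathSum A₁ B₁ (q + 1) (q + 1) 0 = 0 → X = 0 := by
    intro q X hX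
    rw [pathSum_succ_up _ _ _ _ _ (by lia), pathSum_succ_down' _ _ _ _ _ (by lia), zero_add] at hX
    refine eq_zero_of_isUnit_mul_mul
      (isUnit_pathSum_up B₁ (fun k => (hA₁ k).isUnit) q 1 (q + 1) (by lia))
      (isUnit_pathSum_down B₁ (fun k => (hA₁ k).isUnit) q (q + 1) 1 (by lia))
      ((hA₁ 0).eq_zero_of_mul_add_mul_eq_zero (hA₁ 0) ?_)
    rw [← hX]
    noncomm_ring
  refine eq_of_pathSum_eq_of_right hA₁ hA₂ N h (fun hN => ?_) (fun q hq hA hB => ?_)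
    (fun q hq hA hB => ?_) N le_rfl
  · have h₁ : A₁ 0 - A₂ 0 + A₁ 0 - A₂ 0 = 0 := by simpa [pathSum] using h' 1 (by lia)
    have h₂ : (2 : ℂ) • (A₁ 0 - A₂ 0) = 0 := by
      rw [← h₁, two_smul]
      abel
    exact sub_eq_zero.1 ((smul_eq_zero.1 h₂).resolve_left two_ne_zero)
  · have h₁ := pathSum_sub_pathSum_offDiag (A₁ := A₁) (A₂ := A₂) (B₁ := B₁) (B₂ := B₂) (q + 1)
      (q + 1) q (fun j h₁ h₂ => hA j (by lia) (by lia)) (fun j h₁ h₂ => hB j (by lia) (by lia))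
    have h₂ := pathSum_sub_pathSum_offDiag (A₁ := A₁) (A₂ := A₂) (B₁ := B₁) (B₂ := B₂) (q + 1)
      q (q + 1) (fun j h₁ h₂ => hA j (by lia) (by lia)) (fun j h₁ h₂ => hB j (by lia) (by lia))
    rw [← add_assoc q, add_right_comm q q 1] at h₂
    push_cast at h₁ h₂
    simp only [sub_self, add_sub_cancel_left] at h₁ h₂
    have h₃ := h' (q + 1 + q + 2) (by lia)
    rw [add_sub_assoc, h₁, h₂] at h₃
    exact (hA₁ _).eq_of_mul_self_eq (hA₂ _) (sub_eq_zero.1 (key q _ h₃))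
  · have h₁ := pathSum_sub_pathSum_diag (A₁ := A₁) (A₂ := A₂) (B₁ := B₁) (B₂ := B₂) (q + 1)
      (q + 1) q (fun j h₁ h₂ => hA j (by lia) (by lia)) (fun j h₁ h₂ => hB j (by lia) (by lia))
    have h₂ := pathSum_sub_pathSum_diag (A₁ := A₁) (A₂ := A₂) (B₁ := B₁) (B₂ := B₂) (q + 1)
      q (q + 1) (fun j h₁ h₂ => hA j (by lia) (by lia)) (fun j h₁ h₂ => hB j (by lia) (by lia))
    rw [← add_assoc q, add_right_comm q q 1] at h₂
    push_cast at h₁ h₂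
    simp only [sub_self, add_sub_cancel_left] at h₁ h₂
    have h₃ := h' (q + 1 + q + 1) (by lia)
    rw [add_sub_assoc, h₁, h₂] at h₃
    exact sub_eq_zero.1 (key q _ h₃)

end Determination

/-! ### Asymptotic expansion of the resolvent -/

section Expansion

open Filter Asymptotics Bornology Topology

variable {V W : Type*} [NormedAddCommGroup V] [NormedSpace ℂ V] [NormedAddCommGroup W]
  [NormedSpace ℂ W]

/-- `F z ~ ∑ z⁻ⁿ⁻¹ d n` as an asymptotic expansion along the filter `l`. -/
def HasMomentExpansion (l : Filter ℂ) (F : ℂ → V) (d : ℕ → V) : Prop :=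
  ∀ M : ℕ, (fun z => F z - ∑ n ∈ Finset.range M, z⁻¹ ^ (n + 1) • d n) =O[l] fun z => z⁻¹ ^ (M + 1)

namespace HasMomentExpansion

variable {l l' : Filter ℂ} {F F' : ℂ → V} {d d' : ℕ → V}

theorem mono (h : HasMomentExpansion l F d) (hl : l' ≤ l) : HasMomentExpansion l' F d :=
  fun M => (h M).mono hl

theorem add (h : HasMomentExpansion l F d) (h' : HasMomentExpansion l F' d') :
    HasMomentExpansion l (fun z => F z + F' z) (fun n => d n + d' n) := fun M => by
  refine ((h M).add (h' M)).congr_left fun z => ?_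
  simp only [smul_add, Finset.sum_add_distrib]
  abel

theorem map (L : V →L[ℂ] W) (h : HasMomentExpansion l F d) :
    HasMomentExpansion l (fun z => L (F z)) (fun n => L (d n)) := fun M =>
  ((L.isBigO_comp _ l).trans (h M)).congr_left fun z => by simp

theorem neg (h : HasMomentExpansion l F d) :
    HasMomentExpansion l (fun z => -F z) (fun n => -d n) :=
  h.map (-ContinuousLinearMap.id ℂ V)

theorem sub (h : HasMomentExpansion l F d) (h' : HasMomentExpansion l F' d') :
    HasMomentExpansion l (fun z => F z - F' z) (fun n => d n - d' n) := by
  simpa only [sub_eq_add_neg] using h.add h'.neg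

/-- Once the earlier coefficients vanish, `z⁻ⁿ⁻¹ d n` is `O(z⁻ⁿ⁻²)`, so the constant `d n` is
`O(z⁻¹)` and tends to zero along a nontrivial filter. -/
theorem eq_zero [l.NeBot] (hl : l ≤ cobounded ℂ) (h : HasMomentExpansion l F d) {K : ℕ}
    (hF : F =O[l] fun z => z⁻¹ ^ (K + 1)) {n : ℕ} (hn : n < K) : d n = 0 := by
  induction n using Nat.strong_induction_on with
  | _ n ih =>
    have hinv : Tendsto (fun z : ℂ => z⁻¹) l (𝓝 0) := tendsto_inv₀_cobounded.mono_left hl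
    have hne : ∀ᶠ z : ℂ in l, z ≠ 0 := hl (eventually_ne_cobounded 0)
    have h₁ : (fun z => z⁻¹ ^ (K + 1)) =O[l] fun z : ℂ => z⁻¹ ^ (n + 2) := by
      obtain ⟨c, rfl⟩ : ∃ c, K = n + 1 + c := ⟨K - (n + 1), by lia⟩
      have h₂ := (hinv.pow c).isBigO_one ℂ
      refine ((isBigO_refl (fun z : ℂ => z⁻¹ ^ (n + 2)) l).mul h₂).congr (fun z => ?_)
        fun z => mul_one _
      ring
    have h₂ : (fun z => z⁻¹ ^ (n + 1) • d n) =O[l] fun z => z⁻¹ ^ (n + 2) := by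
      refine ((hF.trans h₁).sub (h (n + 1))).congr_left fun z => ?_
      rw [Finset.sum_range_succ, Finset.sum_eq_zero fun i hi => ?_]
      · abel
      · rw [ih i (Finset.mem_range.1 hi) ((Finset.mem_range.1 hi).trans hn), smul_zero]
    have h₃ : (fun _ : ℂ => d n) =O[l] fun z => z⁻¹ := by
      refine ((isBigO_refl (fun z : ℂ => z ^ (n + 1)) l).smul h₂).congr' ?_ ?_
      · filter_upwards [hne] with z hz
        rw [smul_smul, ← mul_pow, mul_inv_cancel₀ hz, one_pow, one_smul]
      · filter_upwards [hne] with z hz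
        rw [smul_eq_mul, pow_succ z⁻¹ (n + 1), ← mul_assoc, ← mul_pow, mul_inv_cancel₀ hz,
          one_pow, one_mul]
    exact tendsto_nhds_unique tendsto_const_nhds (h₃.trans_tendsto hinv)

end HasMomentExpansion

theorem ringInverse_neg {R : Type*} [Ring R] (a : R) : Ring.inverse (-a) = -Ring.inverse a := by
  by_cases ha : IsUnit a
  · obtain ⟨u, rfl⟩ := ha
    rw [← Units.val_neg, Ring.inverse_unit, Ring.inverse_unit, ← Units.val_neg, inv_neg]
  · rw [Ring.inverse_non_unit _ ha, Ring.inverse_non_unit _ (by rwa [IsUnit.neg_iff]), neg_zero]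

/-- The remainder after `M` terms is exactly `resolvent a z * (z⁻ᴹ aᴹ)`, and the resolvent itself is
`O(z⁻¹)`. -/
theorem hasMomentExpansion_resolvent {R : Type*} [NormedRing R] [NormedAlgebra ℂ R]
    [CompleteSpace R] (a : R) :
    HasMomentExpansion (cobounded ℂ) (resolvent a) fun n => a ^ n := fun M => by
  have h₁ : ∀ᶠ z in cobounded ℂ, resolvent a z * (z⁻¹ ^ M • a ^ M)
      = resolvent a z - ∑ n ∈ Finset.range M, z⁻¹ ^ (n + 1) • a ^ n := by
    filter_upwards [spectrum.eventually_isUnit_resolvent (𝕜 := ℂ) a, eventually_ne_cobounded 0]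
      with z hz hz₀
    have hr : resolvent a z * a = z • resolvent a z - 1 := by
      have h := Ring.inverse_mul_cancel _ (spectrum.isUnit_resolvent.2 hz)
      rw [mul_sub, ← Algebra.commutes, ← Algebra.smul_def] at h
      rw [← h, resolvent]
      abel
    induction M with
    | zero => simp
    | succ M ih =>
      rw [Finset.sum_range_succ, ← sub_sub, ← ih, pow_succ' a, mul_smul_comm, ← mul_assoc, hr,
        mul_smul_comm, sub_mul, smul_sub, one_mul, smul_mul_assoc, smul_smul, pow_succ, mul_assoc,
        inv_mul_cancel₀ hz₀, mul_one]
  have h₂ : (fun z : ℂ => z⁻¹ ^ M • a ^ M) =O[cobounded ℂ] fun z => z⁻¹ ^ M :=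
    IsBigO.of_bound ‖a ^ M‖ (Eventually.of_forall fun z => by rw [norm_smul, mul_comm])
  refine ((spectrum.resolvent_isBigO_inv a).mul h₂).congr' h₁ (Eventually.of_forall fun z => ?_)
  exact (pow_succ' _ _).symm

/-- Without this the estimates along the ray could hold vacuously. The bounds on `ε` put `π - ε` in
the range of the principal argument. -/
theorem rayAtInfinity_neBot {ε : ℝ} (hε₀ : 0 < ε) (hεπ : ε < Real.pi) :
    (rayAtInfinity ε).NeBot := by
  have h : Tendsto (fun r : ℝ => (r : ℂ) * Complex.exp ((Real.pi - ε : ℝ) * Complex.I)) atTop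
      (rayAtInfinity ε) := by
    refine tendsto_inf.2 ⟨?_, tendsto_principal.2 ?_⟩
    · rw [← tendsto_norm_atTop_iff_cobounded]
      refine tendsto_abs_atTop_atTop.congr fun r => ?_
      rw [norm_mul, Complex.norm_exp_ofReal_mul_I, mul_one, Complex.norm_real, Real.norm_eq_abs]
    · filter_upwards [eventually_gt_atTop 0] with r hr
      rw [Complex.arg_real_mul _ hr, Complex.arg_exp_mul_I, toIocMod_eq_self]
      constructor <;> linarith
  exact h.neBot

theorem rayAtInfinity_le_cobounded (ε : ℝ) : rayAtInfinity ε ≤ cobounded ℂ := inf_le_left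

end Expansion

/-! ### Moments and Green's matrices of the Jacobi operator -/

/-- The block at position `(k, l)` of an operator on `ℓ²(ℤ)^m`. -/
noncomputable def blockEntry {m : ℕ} (k l : ℤ) :
    (EllTwo m →L[ℂ] EllTwo m) →L[ℂ] Matrix (Fin m) (Fin m) ℂ where
  toFun T := Matrix.of fun i j =>
    (T (lp.single 2 l (EuclideanSpace.single j (1 : ℂ))) : EllTwo m) k i
  map_add' _ _ := rfl
  map_smul' _ _ := rfl
  cont := by
    refine continuous_matrix fun i j => ?_
    exact (EuclideanSpace.proj i).continuous.comp <| (lp.evalCLM ℂ _ 2 k).continuous.comp <|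
      continuous_eval_const (lp.single 2 l (EuclideanSpace.single j (1 : ℂ)) : EllTwo m)

namespace JacobiCoeff

open Filter Asymptotics Bornology

variable {m : ℕ}

theorem blockEntry_H_pow (J : JacobiCoeff m) (n : ℕ) (k l : ℤ) :
    blockEntry k l (J.H ^ n) = pathSum J.A J.B n k l := by
  induction n generalizing k with
  | zero =>
    ext i j
    change (lp.single 2 l (EuclideanSpace.single j (1 : ℂ)) : EllTwo m) k i = _
    by_cases h : k = l
    · subst h
      simp [Matrix.one_apply]
    · simp [pathSum, h]
  | succ n ih =>
    rw [pathSum_succ, ← ih, ← ih, ← ih]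
    ext i j
    have h : blockEntry k l (J.H ^ (n + 1)) i j
        = (J.H ((J.H ^ n) (lp.single 2 l (EuclideanSpace.single j (1 : ℂ)))) : EllTwo m) k i := by
      rw [pow_succ']
      rfl
    rw [h, H_apply]
    rfl

theorem hasMomentExpansion_G (J : JacobiCoeff m) (k l : ℤ) :
    HasMomentExpansion (cobounded ℂ) (fun z => J.G z k l) fun n => -pathSum J.A J.B n k l := by
  have h := ((hasMomentExpansion_resolvent J.H).map (blockEntry k l)).neg
  simp only [blockEntry_H_pow] at h
  convert h using 2 with z
  -- `resolvent` inverts `z - H` while `G` inverts `H - z`; hence the sign.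
  rw [← map_neg, resolvent, ← ringInverse_neg, neg_sub, Algebra.algebraMap_eq_smul_one]
  rfl

end JacobiCoeff

open Filter Asymptotics in
theorem isBigO_inv_pow_of_norm_le {V : Type*} [NormedAddCommGroup V] {l : Filter ℂ} {F : ℂ → V}
    {f : ℂ → ℝ} {K : ℕ} {e : ℤ} (he : e = -(K : ℤ)) (hF : ∀ z, ‖F z‖ ≤ f z)
    (hf : f =O[l] fun z => ‖z‖ ^ e) : F =O[l] fun z => z⁻¹ ^ K := by
  refine ((IsBigO.of_norm_le hF).trans hf).trans (isBigO_of_le l fun z => ?_)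
  rw [he, zpow_neg, zpow_natCast, norm_inv, norm_pow, norm_pow, norm_norm, norm_inv, inv_pow]

theorem JacobiCoeff.pathSum_eq_of_isBigO {m : ℕ} {ε : ℝ} (hε₀ : 0 < ε) (hεπ : ε < Real.pi)
    (J₁ J₂ : JacobiCoeff m) (k l : ℤ) {K : ℕ}
    (h : (fun z => J₁.G z k l - J₂.G z k l) =O[rayAtInfinity ε] fun z => z⁻¹ ^ (K + 1))
    {n : ℕ} (hn : n < K) : pathSum J₁.A J₁.B n k l = pathSum J₂.A J₂.B n k l := by
  have := rayAtInfinity_neBot hε₀ hεπ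
  have h₁ := (((J₁.hasMomentExpansion_G k l).sub (J₂.hasMomentExpansion_G k l)).mono
    (rayAtInfinity_le_cobounded ε)).eq_zero (rayAtInfinity_le_cobounded ε) h hn
  rwa [sub_eq_zero, neg_inj] at h₁

theorem theorem4p6 {m : ℕ} (ε : ℝ) (hε₀ : 0 < ε) (hεπ : ε < Real.pi)
    (J₁ J₂ : JacobiCoeff m) (k₀ : ℤ) (N : ℕ) (hN : 2 ≤ N)
    (hyp :
      -- condition (i)
      ((fun z : ℂ => ‖J₁.g z k₀ - J₂.g z k₀‖ + ‖J₁.G z k₀ (k₀ + 1) - J₂.G z k₀ (k₀ + 1)‖)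
          =O[rayAtInfinity ε] fun z : ℂ => ‖z‖ ^ (-((N : ℤ) + 2)))
      ∨
      -- condition (ii)
      ((fun z : ℂ => ‖J₁.g z k₀ - J₂.g z k₀‖ +
            ‖J₁.G z k₀ (k₀ + 1) - J₂.G z k₀ (k₀ + 1)
              + J₁.G z (k₀ + 1) k₀ - J₂.G z (k₀ + 1) k₀‖)
          =O[rayAtInfinity ε] fun z : ℂ => ‖z‖ ^ (-((N : ℤ) + 2)))
      ∨
      -- condition (iii)
      (J₁.A k₀ = J₂.A k₀ ∧
        ((fun z : ℂ => ‖J₁.g z k₀ - J₂.g z k₀‖)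
          =O[rayAtInfinity ε] fun z : ℂ => ‖z‖ ^ (-((N : ℤ) + 2))) ∧
        ((fun z : ℂ => ‖J₁.g z (k₀ + 1) - J₂.g z (k₀ + 1)‖)
          =O[rayAtInfinity ε] fun z : ℂ => ‖z‖ ^ (-(N : ℤ))))) :
    (∀ k : ℕ, k ≤ N / 2 - 1 →
        J₁.A (k₀ + k) = J₂.A (k₀ + k) ∧ J₁.A (k₀ - k) = J₂.A (k₀ - k)) ∧
    (∀ k : ℕ, k ≤ (N - 1) / 2 →
        J₁.B (k₀ + k) = J₂.B (k₀ + k) ∧ J₁.B (k₀ - k) = J₂.B (k₀ - k)) := by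
  have := rayAtInfinity_neBot hε₀ hεπ
  have hA₁ : ∀ k, (J₁.A (k₀ + k)).PosDef := fun k => J₁.posDef_A _
  have hA₂ : ∀ k, (J₂.A (k₀ + k)).PosDef := fun k => J₂.posDef_A _
  -- Decay of order `K + 1` with `K = N + 1` equates the moments of order `n < K`, that is `n ≤ N`.
  have he : -((N : ℤ) + 2) = -((N + 1 + 1 : ℕ) : ℤ) := by push_cast; ring
  have hg : ∀ f : ℂ → ℝ, (∀ z, ‖J₁.g z k₀ - J₂.g z k₀‖ ≤ f z) →
      f =O[rayAtInfinity ε] (fun z : ℂ => ‖z‖ ^ (-((N : ℤ) + 2))) → ∀ n ≤ N,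
      pathSum (fun k => J₁.A (k₀ + k)) (fun k => J₁.B (k₀ + k)) n 0 0
        = pathSum (fun k => J₂.A (k₀ + k)) (fun k => J₂.B (k₀ + k)) n 0 0 := by
    intro f hf hO n hn
    rw [pathSum_shift, pathSum_shift, add_zero]
    exact J₁.pathSum_eq_of_isBigO hε₀ hεπ J₂ k₀ k₀ (isBigO_inv_pow_of_norm_le he hf hO)
      (Nat.lt_succ_of_le hn)
  have key : (∀ j : ℤ, 2 * (j + 1) ≤ N → -2 * j ≤ N → J₁.A (k₀ + j) = J₂.A (k₀ + j)) ∧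
      (∀ j : ℤ, 2 * j + 1 ≤ N → -2 * j + 1 ≤ N → J₁.B (k₀ + j) = J₂.B (k₀ + j)) := by
    rcases hyp with hyp | hyp | ⟨h₀, h, h'⟩
    · refine eq_of_pathSum_zero_one_eq hA₁ hA₂ N
        (hg _ (fun z => le_add_of_nonneg_right (norm_nonneg _)) hyp) fun n hn => ?_
      rw [pathSum_shift, pathSum_shift, add_zero]
      exact J₁.pathSum_eq_of_isBigO hε₀ hεπ J₂ _ _ (isBigO_inv_pow_of_norm_le he
        (fun z => le_add_of_nonneg_left (norm_nonneg _)) hyp) (Nat.lt_succ_of_le hn)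
    · refine eq_of_pathSum_zero_one_add_eq hA₁ hA₂ N
        (hg _ (fun z => le_add_of_nonneg_right (norm_nonneg _)) hyp) fun n hn => ?_
      simp only [pathSum_shift, add_zero]
      have h₁ := (((((J₁.hasMomentExpansion_G k₀ (k₀ + 1)).sub
        (J₂.hasMomentExpansion_G k₀ (k₀ + 1))).add (J₁.hasMomentExpansion_G (k₀ + 1) k₀)).sub
        (J₂.hasMomentExpansion_G (k₀ + 1) k₀)).mono (rayAtInfinity_le_cobounded ε)).eq_zero
        (rayAtInfinity_le_cobounded ε) (isBigO_inv_pow_of_norm_le he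
          (fun z => le_add_of_nonneg_left (norm_nonneg _)) hyp) (Nat.lt_succ_of_le hn)
      rw [← neg_eq_zero, ← h₁]
      abel
    · refine eq_of_pathSum_one_one_eq hA₁ hA₂ N (hg _ (fun z => le_rfl) h)
        (by simpa using h₀) fun n hn => ?_
      rw [pathSum_shift, pathSum_shift]
      have he' : -(N : ℤ) = -((N - 1 + 1 : ℕ) : ℤ) := by lia
      exact J₁.pathSum_eq_of_isBigO hε₀ hεπ J₂ _ _
        (isBigO_inv_pow_of_norm_le he' (fun z => le_rfl) h') (by lia)
  simp only [sub_eq_add_neg]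
  -- `N ≥ 2` rules out truncation in `N / 2 - 1`. On the left `key` determines one more `A` than is
  -- claimed.
  exact ⟨fun k hk => ⟨key.1 _ (by lia) (by lia), key.1 _ (by lia) (by lia)⟩,
    fun k hk => ⟨key.2 _ (by lia) (by lia), key.2 _ (by lia) (by lia)⟩⟩
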